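/- For a finite group $G$, let $D(G)$ be the simple graph obtained as follows: join two distinct elements $a,b\in G$ by an edge if there is $c\in G$ with $a,b\in\langle c\rangle$, while $a\notin\langle b\rangle$ and $b\notin\langle a\rangle$; then remove all isolated vertices. (In other words, $D(G)$ is the difference of the enhanced power graph and the power graph of $G$, with isolated vertices removed.) A finite graph is called perfect if the chromatic number of each of its induced subgraphs equals the clique number of that subgraph. Theorem. Let $p$ and $q$ be distinct primes and let $G$ be a group of order $p^2q^2$. Then $D(G)$ is perfect. -/

import Mathlib

/-- The power graph of `G`: distinct `a`, `b` are adjacent if one is a power of the other. -/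
def powerGraph (G : Type*) [Group G] : SimpleGraph G where
  Adj a b := a ≠ b ∧ (a ∈ Subgroup.zpowers b ∨ b ∈ Subgroup.zpowers a)
  symm := ⟨fun _ _ h => ⟨h.1.symm, h.2.symm⟩⟩
  loopless := ⟨fun _ h => h.1 rfl⟩

/-- The enhanced power graph of `G`: distinct `a`, `b` are adjacent if both are powers of a common
element `c`. -/
def enhancedPowerGraph (G : Type*) [Group G] : SimpleGraph G where
  Adj a b := a ≠ b ∧ ∃ c : G, a ∈ Subgroup.zpowers c ∧ b ∈ Subgroup.zpowers c
  symm := ⟨fun _ _ h => ⟨h.1.symm, h.2.imp fun _ hc => hc.symm⟩⟩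
  loopless := ⟨fun _ h => h.1 rfl⟩

/-- The graph on all of `G` whose edges are the edges of the enhanced power graph that are not
edges of the power graph. -/
def fullDifferenceGraph (G : Type*) [Group G] : SimpleGraph G :=
  enhancedPowerGraph G \ powerGraph G

/-- The difference graph `D(G)`: the isolated vertices are removed, so that the vertex set is the
set of vertices having at least one neighbour. -/
def differenceGraph (G : Type*) [Group G] : SimpleGraph (fullDifferenceGraph G).support :=
  (fullDifferenceGraph G).induce (fullDifferenceGraph G).support

/-- A finite graph is perfect if in each of its induced subgraphs the chromatic number equals the
clique number. -/
def IsPerfectGraph {V : Type*} [Finite V] (Γ : SimpleGraph V) : Prop :=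
  ∀ s : Set V, (Γ.induce s).chromaticNumber = ((Γ.induce s).cliqueNum : ℕ∞)

/-! Inside a cyclic subgroup, membership in `zpowers` is divisibility of orders. So two elements are
adjacent exactly when they lie in a common cyclic subgroup and the exponents of `p` and `q` in their
orders differ in opposite directions. If `G` is cyclic, this is comparability for a transitive
relation. If no order is divisible by `p * q ^ 2` (or, symmetrically, by `p ^ 2 * q`), the graph is
bipartite. Otherwise both kinds of order occur, and `isCyclic_of_dvd_orderOf` makes `G` cyclic. Both
graph types are comparability graphs, hence perfect. -/

namespace SimpleGraph

/-! ### Comparability graphs -/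

variable {V : Type*}

/-- The comparability graph of a transitive relation on a finite type has a colouring with as many
colours as its clique number: a vertex is coloured by the largest size of a clique below it. -/
theorem chromaticNumber_eq_cliqueNum_of_transitive [Finite V] (Γ : SimpleGraph V)
    (r : V → V → Prop) (htrans : ∀ a b c, r a b → r b c → r a c)
    (hadj : ∀ a b, Γ.Adj a b ↔ r a b ∨ r b a) :
    Γ.chromaticNumber = (Γ.cliqueNum : ℕ∞) := by
  classical
  have := Fintype.ofFinite V
  refine le_antisymm ?_ Γ.cliqueNum_le_chromaticNumber
  apply Colorable.chromaticNumber_le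
  let below : V → Finset (Finset V) := fun x =>
    Finset.univ.filter fun s => Γ.IsClique (s : Set V) ∧ ∀ y ∈ s, r y x
  let h : V → ℕ := fun x => (below x).sup Finset.card
  have hinsert : ∀ x, ∀ s ∈ below x,
      x ∉ s ∧ Γ.IsClique ((insert x s : Finset V) : Set V) := by
    intro x s hs
    obtain ⟨hclique, hlt⟩ := (Finset.mem_filter.mp hs).2
    refine ⟨fun hx => Γ.loopless.irrefl x ((hadj x x).2 (.inl (hlt x hx))), ?_⟩
    rw [Finset.coe_insert]
    exact hclique.insert fun y hy _ => (hadj x y).2 (.inr (hlt y hy))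
  have hmax : ∀ x, ∃ s ∈ below x, s.card = h x := by
    intro x
    have hne : (below x).Nonempty := ⟨∅, by simp [below]⟩
    obtain ⟨s, hs, hsx⟩ := Finset.exists_mem_eq_sup (below x) hne Finset.card
    exact ⟨s, hs, hsx.symm⟩
  -- Strict, because `x` itself enlarges any clique below it; so the colours fit in `Fin
  -- Γ.cliqueNum`.
  have hlt : ∀ x, h x < Γ.cliqueNum := by
    intro x
    obtain ⟨s, hs, hsx⟩ := hmax x
    obtain ⟨hx, hclique⟩ := hinsert x s hs
    have := hclique.card_le_cliqueNum
    rw [Finset.card_insert_of_notMem hx] at this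
    omega
  have hmono : ∀ x y, r x y → h x < h y := by
    intro x y hxy
    obtain ⟨s, hs, hsx⟩ := hmax x
    obtain ⟨hx, hclique⟩ := hinsert x s hs
    have hmem : insert x s ∈ below y := by
      refine Finset.mem_filter.mpr ⟨Finset.mem_univ _, hclique, fun z hz => ?_⟩
      rcases Finset.mem_insert.mp hz with rfl | hz
      · exact hxy
      · exact htrans z x y ((Finset.mem_filter.mp hs).2.2 z hz) hxy
    have hle : (insert x s).card ≤ h y := Finset.le_sup (f := Finset.card) hmem
    rw [Finset.card_insert_of_notMem hx] at hle
    omega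
  refine ⟨Coloring.mk (fun x => (⟨h x, hlt x⟩ : Fin Γ.cliqueNum)) ?_⟩
  intro x y hxy heq
  have heq' : h x = h y := congrArg Fin.val heq
  rcases (hadj x y).1 hxy with hr | hr
  · exact (hmono x y hr).ne heq'
  · exact (hmono y x hr).ne' heq'

end SimpleGraph

/-- Induced subgraphs of comparability graphs are perfect. -/
theorem isPerfectGraph_induce_of_transitive {V : Type*} [Finite V] (Γ : SimpleGraph V)
    (r : V → V → Prop) (htrans : ∀ a b c, r a b → r b c → r a c)
    (hadj : ∀ a b, Γ.Adj a b ↔ r a b ∨ r b a) (t : Set V) :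
    IsPerfectGraph (Γ.induce t) := fun _ =>
  SimpleGraph.chromaticNumber_eq_cliqueNum_of_transitive _ (fun a b => r a.1.1 b.1.1)
    (fun _ _ _ => htrans _ _ _) (fun _ _ => hadj _ _)

/-! ### Adjacency in terms of element orders -/

section Group

variable {G : Type*} [Group G] [Finite G]

/-- A cyclic group has at most `n` solutions of `x ^ n = 1`; for `n = orderOf b` the powers of `b`
already exhaust them. -/
theorem mem_zpowers_of_orderOf_dvd {a b c : G} (ha : a ∈ Subgroup.zpowers c)
    (hb : b ∈ Subgroup.zpowers c) (h : orderOf a ∣ orderOf b) : a ∈ Subgroup.zpowers b := by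
  classical
  have := Fintype.ofFinite G
  obtain ⟨a, rfl⟩ : ∃ x : Subgroup.zpowers c, (x : G) = a := ⟨⟨a, ha⟩, rfl⟩
  obtain ⟨b, rfl⟩ : ∃ x : Subgroup.zpowers c, (x : G) = b := ⟨⟨b, hb⟩, rfl⟩
  rw [Subgroup.orderOf_coe, Subgroup.orderOf_coe] at h
  suffices a ∈ Subgroup.zpowers b by
    obtain ⟨k, rfl⟩ := this
    exact ⟨k, by simp⟩
  have hsub : ((Subgroup.zpowers b : Set (Subgroup.zpowers c)).toFinset) ⊆
      Finset.univ.filter fun x => x ^ orderOf b = 1 := by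
    intro x hx
    rw [Set.mem_toFinset] at hx
    simpa using orderOf_dvd_iff_pow_eq_one.mp (orderOf_dvd_of_mem_zpowers hx)
  have hcard : (Finset.univ.filter fun x : Subgroup.zpowers c => x ^ orderOf b = 1).card ≤
      ((Subgroup.zpowers b : Set (Subgroup.zpowers c)).toFinset).card := by
    refine (IsCyclic.card_pow_eq_one_le (orderOf_pos b)).trans_eq ?_
    rw [Set.toFinset_card, ← Nat.card_eq_fintype_card]
    exact (Nat.card_zpowers b).symm
  have heq := Finset.eq_of_subset_of_card_le hsub hcard
  have hmem : a ∈ Finset.univ.filter fun x : Subgroup.zpowers c => x ^ orderOf b = 1 := by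
    simpa using orderOf_dvd_iff_pow_eq_one.mp h
  rw [← heq, Set.mem_toFinset] at hmem
  exact hmem

theorem mem_zpowers_iff_orderOf_dvd {a b c : G} (ha : a ∈ Subgroup.zpowers c)
    (hb : b ∈ Subgroup.zpowers c) : a ∈ Subgroup.zpowers b ↔ orderOf a ∣ orderOf b :=
  ⟨orderOf_dvd_of_mem_zpowers, mem_zpowers_of_orderOf_dvd ha hb⟩

theorem fullDifferenceGraph_adj_iff {a b : G} :
    (fullDifferenceGraph G).Adj a b ↔
      (∃ c : G, a ∈ Subgroup.zpowers c ∧ b ∈ Subgroup.zpowers c) ∧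
        ¬ orderOf a ∣ orderOf b ∧ ¬ orderOf b ∣ orderOf a := by
  constructor
  · rintro ⟨⟨hne, c, ha, hb⟩, hpow⟩
    rw [← mem_zpowers_iff_orderOf_dvd ha hb, ← mem_zpowers_iff_orderOf_dvd hb ha]
    exact ⟨⟨c, ha, hb⟩, fun h => hpow ⟨hne, .inl h⟩, fun h => hpow ⟨hne, .inr h⟩⟩
  · rintro ⟨⟨c, ha, hb⟩, h₁, h₂⟩
    rw [← mem_zpowers_iff_orderOf_dvd ha hb] at h₁
    rw [← mem_zpowers_iff_orderOf_dvd hb ha] at h₂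
    refine ⟨⟨?_, c, ha, hb⟩, fun h => h.2.elim h₁ h₂⟩
    rintro rfl
    exact h₁ (Subgroup.mem_zpowers a)

theorem dvd_iff_factorization_le_of_dvd {p q m n : ℕ} (hp : p.Prime) (hq : q.Prime)
    (hm : m ∣ p ^ 2 * q ^ 2) (hn : n ∣ p ^ 2 * q ^ 2) :
    m ∣ n ↔ m.factorization p ≤ n.factorization p ∧ m.factorization q ≤ n.factorization q := by
  have hpos : p ^ 2 * q ^ 2 ≠ 0 := by have := hp.pos; have := hq.pos; positivity
  have hm0 := ne_zero_of_dvd_ne_zero hpos hm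
  have hn0 := ne_zero_of_dvd_ne_zero hpos hn
  rw [← Nat.factorization_le_iff_dvd hm0 hn0]
  refine ⟨fun h => ⟨h p, h q⟩, fun h r => ?_⟩
  by_cases hrp : r = p
  · exact hrp ▸ h.1
  by_cases hrq : r = q
  · exact hrq ▸ h.2
  have hr : m.factorization r = 0 := by
    rw [Nat.factorization_eq_zero_iff]
    by_contra! hcon
    rcases (Nat.Prime.dvd_mul hcon.1).1 (hcon.2.1.trans hm) with h' | h'
    · exact hrp ((Nat.prime_dvd_prime_iff_eq hcon.1 hp).1 (hcon.1.dvd_of_dvd_pow h'))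
    · exact hrq ((Nat.prime_dvd_prime_iff_eq hcon.1 hq).1 (hcon.1.dvd_of_dvd_pow h'))
  omega

theorem factorization_le_two_of_dvd {p q m : ℕ} (hp : p.Prime) (hq : q.Prime) (hpq : p ≠ q)
    (hm : m ∣ p ^ 2 * q ^ 2) : m.factorization p ≤ 2 := by
  have hpos : p ^ 2 * q ^ 2 ≠ 0 := by have := hp.pos; have := hq.pos; positivity
  refine ((Nat.factorization_le_iff_dvd (ne_zero_of_dvd_ne_zero hpos hm) hpos).2 hm p).trans ?_
  rw [Nat.factorization_mul (pow_ne_zero _ hp.ne_zero) (pow_ne_zero _ hq.ne_zero)]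
  simp [hp.factorization, hq.factorization, hpq.symm]

/-! ### A criterion for cyclicity -/

/-- A cyclic subgroup of order `p ^ 2` centralized by an element of order `q < p` is normal. -/
theorem zpowers_normal_of_orderOf {p q : ℕ} (hp : p.Prime) (hq : q.Prime) (hlt : q < p)
    (hG : Nat.card G = p ^ 2 * q ^ 2) {x : G} (hx : orderOf x = p ^ 2 * q) :
    (Subgroup.zpowers (x ^ q)).Normal := by
  have := Fact.mk hp
  have ha : orderOf (x ^ q) = p ^ 2 := by
    rw [orderOf_pow_of_dvd hq.ne_zero (by rw [hx]; exact Dvd.intro_left _ rfl), hx,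
      Nat.mul_div_cancel _ hq.pos]
  have hfact : (Nat.card G).factorization p = 2 := by
    rw [hG, Nat.factorization_mul (pow_ne_zero _ hp.ne_zero) (pow_ne_zero _ hq.ne_zero)]
    simp [hp.factorization, hq.factorization, hlt.ne]
  let P : Sylow p G := Sylow.ofCard (Subgroup.zpowers (x ^ q)) (by
    rw [Nat.card_zpowers, ha, hfact])
  have hP : (P : Subgroup G) = Subgroup.zpowers (x ^ q) := rfl
  have hle : Subgroup.zpowers x ≤ Subgroup.normalizer (P : Set G) := by
    rw [Subgroup.zpowers_le]
    refine (Subgroup.mem_normalizer_iff (H := (P : Subgroup G))).2 fun y => ?_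
    rw [hP]
    have hcomm : ∀ z ∈ Subgroup.zpowers (x ^ q), x * z = z * x := by
      rintro _ ⟨k, rfl⟩
      exact ((Commute.refl x).pow_right q).zpow_right k
    constructor
    · intro hy
      rwa [hcomm y hy, mul_inv_cancel_right]
    · intro hy
      have h' := hcomm _ hy
      have : x * y * x⁻¹ = y := by
        have h'' : x * (x * y * x⁻¹) = x * y := by rw [h']; group
        exact mul_left_cancel h''
      rwa [this] at hy
  have hcard : p ^ 2 * q ∣ Nat.card (Subgroup.normalizer (P : Set G)) := by
    have := Subgroup.card_dvd_of_le hle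
    rwa [Nat.card_zpowers, hx] at this
  have hindex : (Subgroup.normalizer (P : Set G)).index ∣ q := by
    have hmul := (Subgroup.normalizer (P : Set G)).card_mul_index
    obtain ⟨k, hk⟩ := hcard
    rw [hG, hk] at hmul
    refine ⟨k, ?_⟩
    have hpos : 0 < p ^ 2 * q := by have := hp.pos; have := hq.pos; positivity
    apply Nat.eq_of_mul_eq_mul_left hpos
    rw [show p ^ 2 * q * q = p ^ 2 * q ^ 2 by ring, ← hmul]
    ring
  -- The index counts the Sylow `p`-subgroups, so it is 1 mod `p`; this excludes `q`, since `1 < q <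
  -- p`.
  have hmod := card_sylow_modEq_one p G
  rw [P.card_eq_index_normalizer] at hmod
  have hone : (Subgroup.normalizer (P : Set G)).index = 1 := by
    rcases (Nat.dvd_prime hq).1 hindex with h | h
    · exact h
    · rw [h] at hmod
      exact absurd (Nat.ModEq.eq_of_lt_of_lt hmod hlt hp.one_lt) hq.one_lt.ne'
  exact Subgroup.normalizer_eq_top_iff.mp (Subgroup.index_eq_one.mp hone)

/-- With `a = x ^ q` and `b = y ^ p` generating Sylow subgroups, it suffices that `a` and `b`
commute. The commutator `w` of `b` and `a` lies in the order-`p` subgroup of the normal subgroup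
generated by `a`. That subgroup is generated by a power of `y`, so `b` centralizes it; then `w` has
order dividing both `p` and `q ^ 2`. -/
theorem isCyclic_of_orderOf_of_lt {p q : ℕ} (hp : p.Prime) (hq : q.Prime) (hlt : q < p)
    (hG : Nat.card G = p ^ 2 * q ^ 2) {x y : G} (hx : orderOf x = p ^ 2 * q)
    (hy : orderOf y = p * q ^ 2) : IsCyclic G := by
  have hN := zpowers_normal_of_orderOf hp hq hlt hG hx
  have hcop : Nat.Coprime p q := (Nat.coprime_primes hp hq).2 hlt.ne'
  have ha : orderOf (x ^ q) = p ^ 2 := by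
    rw [orderOf_pow_of_dvd hq.ne_zero (by rw [hx]; exact Dvd.intro_left _ rfl), hx,
      Nat.mul_div_cancel _ hq.pos]
  have hb : orderOf (y ^ p) = q ^ 2 := by
    rw [orderOf_pow_of_dvd hp.ne_zero (by rw [hy]; exact Dvd.intro _ rfl), hy,
      Nat.mul_div_cancel_left _ hp.pos]
  have hu : orderOf (y ^ q ^ 2) = p := by
    rw [orderOf_pow_of_dvd (pow_ne_zero _ hq.ne_zero) (by rw [hy]; exact Dvd.intro_left _ rfl),
      hy, Nat.mul_div_cancel _ (pow_pos hq.pos 2)]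
  have hbu : Commute (y ^ p) (y ^ q ^ 2) := Commute.pow_pow_self y _ _
  generalize x ^ q = a at *
  generalize y ^ p = b at *
  generalize y ^ q ^ 2 = u at *
  have hap : orderOf (a ^ p) = p := by
    rw [orderOf_pow_of_dvd hp.ne_zero (by rw [ha]; exact Dvd.intro _ (sq p).symm), ha, sq,
      Nat.mul_div_cancel _ hp.pos]
  have hua : u ∈ Subgroup.zpowers a := by
    have hindex : Nat.card (G ⧸ Subgroup.zpowers a) = q ^ 2 := by
      have := (Subgroup.zpowers a).card_eq_card_quotient_mul_card_subgroup
      rw [hG, Nat.card_zpowers, ha, mul_comm] at this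
      exact (Nat.eq_of_mul_eq_mul_right (pow_pos hp.pos 2) this).symm
    -- The image of `u` has order dividing both `p` and `q ^ 2`, so it is trivial.
    rw [← QuotientGroup.eq_one_iff, ← orderOf_eq_one_iff]
    apply Nat.eq_one_of_dvd_coprimes (hcop.pow_right 2)
    · have := orderOf_map_dvd (QuotientGroup.mk' (Subgroup.zpowers a)) u
      rwa [hu] at this
    · exact hindex ▸ orderOf_dvd_natCard _
  have hcomm_of_dvd : ∀ z ∈ Subgroup.zpowers a, orderOf z ∣ p → Commute b z := by
    intro z hz hzp
    obtain ⟨k, rfl⟩ := mem_zpowers_of_orderOf_dvd hz hua (hu ▸ hzp)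
    exact hbu.zpow_right k
  have hconj : b * a * b⁻¹ ∈ Subgroup.zpowers a := hN.conj_mem a (Subgroup.mem_zpowers a) b
  have hw : b * a * b⁻¹ * a⁻¹ ∈ Subgroup.zpowers a :=
    mul_mem hconj (inv_mem (Subgroup.mem_zpowers a))
  have hwa : Commute (b * a * b⁻¹) a := by
    obtain ⟨k, hk⟩ := hconj
    rw [← hk]
    exact (Commute.refl a).zpow_left k
  have hwp : (b * a * b⁻¹ * a⁻¹) ^ p = 1 := by
    have hcomm : b * a ^ p = a ^ p * b :=
      hcomm_of_dvd _ (Subgroup.npow_mem_zpowers a p) hap.dvd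
    rw [(hwa.inv_right).mul_pow, conj_pow, hcomm, inv_pow]
    group
  have hbw : Commute b (b * a * b⁻¹ * a⁻¹) :=
    hcomm_of_dvd _ hw (orderOf_dvd_of_pow_eq_one hwp)
  have hb1 : b * a * b⁻¹ = (b * a * b⁻¹ * a⁻¹) * a := by group
  generalize b * a * b⁻¹ * a⁻¹ = w at *
  have hiter : ∀ n : ℕ, b ^ n * a * (b ^ n)⁻¹ = w ^ n * a := by
    intro n
    induction n with
    | zero => simp
    | succ n ih =>
      calc b ^ (n + 1) * a * (b ^ (n + 1))⁻¹ = b * (b ^ n * a * (b ^ n)⁻¹) * b⁻¹ := by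
            rw [pow_succ']; group
        _ = b * w ^ n * a * b⁻¹ := by rw [ih]; group
        _ = w ^ n * (b * a * b⁻¹) := by rw [(hbw.pow_right n).eq]; group
        _ = w ^ (n + 1) * a := by rw [hb1, pow_succ]; group
  -- Since `b ^ q ^ 2 = 1`, the iterated conjugation formula at `n = q ^ 2` reads `a = w ^ q ^ 2 *
  -- a`.
  have hwq : w ^ q ^ 2 = 1 := by
    have := hiter (q ^ 2)
    rw [← hb, pow_orderOf_eq_one] at this
    rw [← hb]
    simpa using this.symm
  have hw1 : w = 1 := by
    rw [← orderOf_eq_one_iff]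
    exact Nat.eq_one_of_dvd_coprimes (hcop.pow_right 2) (orderOf_dvd_of_pow_eq_one hwp)
      (orderOf_dvd_of_pow_eq_one hwq)
  have hab : Commute a b := by
    rw [hw1, one_mul, mul_inv_eq_iff_eq_mul] at hb1
    exact hb1.symm
  apply isCyclic_of_orderOf_eq_card (a * b)
  rw [hab.orderOf_mul_eq_mul_orderOf_of_coprime (by rw [ha, hb]; exact hcop.pow 2 2), ha, hb, hG]

theorem exists_orderOf_eq_of_dvd {n : ℕ} {c : G} (h : n ∣ orderOf c) : ∃ x : G, orderOf x = n :=
  ⟨_, orderOf_pow_orderOf_div (orderOf_pos c).ne' h⟩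

/-- A group of order `p ^ 2 * q ^ 2` with elements of orders divisible by `p ^ 2 * q` and by
`p * q ^ 2` is cyclic. -/
theorem isCyclic_of_dvd_orderOf {p q : ℕ} (hp : p.Prime) (hq : q.Prime) (hpq : p ≠ q)
    (hG : Nat.card G = p ^ 2 * q ^ 2) {c d : G} (hc : p ^ 2 * q ∣ orderOf c)
    (hd : p * q ^ 2 ∣ orderOf d) : IsCyclic G := by
  obtain ⟨x, hx⟩ := exists_orderOf_eq_of_dvd hc
  obtain ⟨y, hy⟩ := exists_orderOf_eq_of_dvd hd
  rcases hpq.lt_or_gt with h | h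
  · exact isCyclic_of_orderOf_of_lt hq hp h (by rw [hG, mul_comm]) (by rw [hy, mul_comm])
      (by rw [hx, mul_comm])
  · exact isCyclic_of_orderOf_of_lt hp hq h hG hx hy

theorem fullDifferenceGraph_adj_iff_factorization {p q : ℕ} (hp : p.Prime) (hq : q.Prime)
    (hG : Nat.card G = p ^ 2 * q ^ 2) {a b : G} :
    (fullDifferenceGraph G).Adj a b ↔
      (∃ c : G, a ∈ Subgroup.zpowers c ∧ b ∈ Subgroup.zpowers c) ∧
        (((orderOf a).factorization p < (orderOf b).factorization p ∧
            (orderOf b).factorization q < (orderOf a).factorization q) ∨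
          ((orderOf b).factorization p < (orderOf a).factorization p ∧
            (orderOf a).factorization q < (orderOf b).factorization q)) := by
  have hdvd : ∀ x : G, orderOf x ∣ p ^ 2 * q ^ 2 := fun x => hG ▸ orderOf_dvd_natCard x
  rw [fullDifferenceGraph_adj_iff, dvd_iff_factorization_le_of_dvd hp hq (hdvd a) (hdvd b),
    dvd_iff_factorization_le_of_dvd hp hq (hdvd b) (hdvd a)]
  refine and_congr_right fun _ => ?_
  omega

/-! ### Perfectness in the two cases -/

/-- If no element has order divisible by `p * q ^ 2`, the elements of order prime to `q` and the
remaining ones form a bipartition. -/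
theorem isPerfectGraph_differenceGraph_of_not_dvd {p q : ℕ} (hp : p.Prime) (hq : q.Prime)
    (hpq : p ≠ q) (hG : Nat.card G = p ^ 2 * q ^ 2) (h : ∀ c : G, ¬ p * q ^ 2 ∣ orderOf c) :
    IsPerfectGraph (differenceGraph G) := by
  have hle : ∀ x : G, (orderOf x).factorization q ≤ 2 := fun x =>
    factorization_le_two_of_dvd hq hp hpq.symm
      (by rw [mul_comm, ← hG]; exact orderOf_dvd_natCard x)
  have hkey : ∀ a b c : G, a ∈ Subgroup.zpowers c → b ∈ Subgroup.zpowers c →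
      (orderOf a).factorization p < (orderOf b).factorization p →
      (orderOf b).factorization q < (orderOf a).factorization q →
      (orderOf b).factorization q = 0 := by
    intro a b c ha hb hpl hql
    by_contra hne
    have := hle a
    -- Here `p` divides the order of `b`, and `q ^ 2` that of `a`; both orders divide that of `c`.
    refine h c (Nat.Coprime.mul_dvd_of_dvd_of_dvd ?_ ?_ ?_)
    · exact ((Nat.coprime_primes hp hq).2 hpq).pow_right 2
    · refine Dvd.dvd.trans ?_ (orderOf_dvd_of_mem_zpowers hb)
      exact Nat.dvd_of_factorization_pos (by omega)
    · refine Dvd.dvd.trans ?_ (orderOf_dvd_of_mem_zpowers ha)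
      exact (hq.pow_dvd_iff_le_factorization (orderOf_pos a).ne').2 (by omega)
  have hone : ∀ a b : G, (fullDifferenceGraph G).Adj a b →
      ((orderOf a).factorization q = 0 ∧ (orderOf b).factorization q ≠ 0) ∨
        ((orderOf b).factorization q = 0 ∧ (orderOf a).factorization q ≠ 0) := by
    intro a b hab
    obtain ⟨⟨c, ha, hb⟩, h' | h'⟩ := (fullDifferenceGraph_adj_iff_factorization hp hq hG).1 hab
    · have := hkey a b c ha hb h'.1 h'.2
      omega
    · have := hkey b a c hb ha h'.1 h'.2
      omega
  refine isPerfectGraph_induce_of_transitive (fullDifferenceGraph G)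
    (fun a b => (fullDifferenceGraph G).Adj a b ∧ (orderOf a).factorization q = 0) ?_ ?_ _
  -- Transitivity is vacuous: edges are directed from one side to the other, so no two are
  -- composable.
  · rintro a b c ⟨hab, ha⟩ ⟨-, hb⟩
    have := hone a b hab
    omega
  · intro a b
    refine ⟨fun hab => ?_, fun h' => h'.elim (fun h' => h'.1) fun h' => h'.1.symm⟩
    rcases hone a b hab with h' | h'
    · exact .inl ⟨hab, h'.1⟩
    · exact .inr ⟨hab.symm, h'.1⟩

theorem isPerfectGraph_differenceGraph_of_isCyclic {p q : ℕ} (hp : p.Prime) (hq : q.Prime)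
    (hG : Nat.card G = p ^ 2 * q ^ 2) [IsCyclic G] : IsPerfectGraph (differenceGraph G) := by
  obtain ⟨g, hg⟩ := IsCyclic.exists_generator (α := G)
  refine isPerfectGraph_induce_of_transitive (fullDifferenceGraph G)
    (fun a b => (orderOf a).factorization p < (orderOf b).factorization p ∧
      (orderOf b).factorization q < (orderOf a).factorization q) ?_ ?_ _
  · intro a b c hab hbc
    exact ⟨hab.1.trans hbc.1, hbc.2.trans hab.2⟩
  · intro a b
    rw [fullDifferenceGraph_adj_iff_factorization hp hq hG]
    exact and_iff_right ⟨g, hg a, hg b⟩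

end Group

theorem theorem7p4 {G : Type*} [Group G] [Finite G] {p q : ℕ} (hp : p.Prime) (hq : q.Prime)
    (hpq : p ≠ q) (hG : Nat.card G = p ^ 2 * q ^ 2) :
    IsPerfectGraph (differenceGraph G) := by
  by_cases hd : ∃ d : G, p * q ^ 2 ∣ orderOf d
  · by_cases hc : ∃ c : G, p ^ 2 * q ∣ orderOf c
    · obtain ⟨c, hc⟩ := hc
      obtain ⟨d, hd⟩ := hd
      have := isCyclic_of_dvd_orderOf hp hq hpq hG hc hd
      exact isPerfectGraph_differenceGraph_of_isCyclic hp hq hG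
    · push Not at hc
      exact isPerfectGraph_differenceGraph_of_not_dvd hq hp hpq.symm (by rw [hG, mul_comm])
        fun c => by rw [mul_comm]; exact hc c
  · push Not at hd
    exact isPerfectGraph_differenceGraph_of_not_dvd hp hq hpq hG hd
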